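/- **Setting.** For an edge $\{u,v\}$ of a finite simple graph $G$, let $G_{u,v}$ be the complete bipartite graph whose left and right nodes are the closed neighbourhoods $L=\{u\}\cup \mathrm{Nbr}_G(u)$ and $R=\{v\}\cup\mathrm{Nbr}_G(v)$ (regarded as disjoint) with edge weights $w(x,y)=\mathrm{dist}_G(x,y)\in\{0,1,2,3\}$. The Ollivier–Ricci curvature is $\mathfrak C_G(e)=1-\mathrm{EMD}$, where $\mathrm{EMD}$ is the optimum of the transportation linear program with costs $w$ between the uniform distributions on $L$ and on $R$. A number $\gamma$ is an $(\alpha,\varepsilon)$-estimate of a curvature $1-\mathrm{OPT}$ if $\mathrm{OPT}\le 1-\gamma\le\alpha\,\mathrm{OPT}+\varepsilon$. A *local algorithm* knows the two lists of nodes of a weighted complete bipartite graph (hence which pairs have weight $0$), may toss coins, and adaptively asks queries: a *weighted node-pair query* $(x,y)$ returns $w(x,y)$; a *weighted neighbor query* $(z,s)$ returns a uniformly random node joined to $z$ by an edge of weight $s$ among those not yet returned by the query $(z,s)$, or a special symbol if there is none; a *weighted selective degree query* $(z,s)$ returns the number of edges of weight $s$ at $z$. The cost is the number of queries. In the *equal-degree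 case* the input is a complete bipartite graph with equally many (at least one) nodes on both sides and weights in $\{0,1,2,3\}$, and its curvature is $1-\mathrm{EMD}$ for the uniform distributions on its sides. "$\mathfrak B$ provides an $(\alpha,\varepsilon)$-estimate with probability at least $p$" means that on each input of the class the output is one with probability at least $p$ ($p$ arbitrary; $p=1$ for algorithms that always succeed). For $\deg_G(u)<\deg_G(v)$ write $\deg_G(v)+1=a(\deg_G(u)+1)+b$ with $0\le b\le\deg_G(u)$. For $c\in\{0,1,2,3\}$ let $G'_{u,v}$ be the complete bipartite graph with right side $R$ and left side consisting of $a$ copies of each $x\in L$, with the weights of $x$, and $b$ special nodes, all of whose edges have weight $c$. Both sides have $\deg_G(v)+1$ nodes. **Theorem.** Let $c\in\{0,1,2,3\}$. There is a procedure with memory that answers queries on $G'_{u,v}$, one at a time, using coin tosses and queries on $G_{u,v}$; it is chosen from the two node lists alone, without knowledge of the nonzero weights, and it has the following properties for every finite simple graph $G$ and every edge $e=\{u,v\}$ with $\deg_G(u)<\deg_G(v)$. (a) For each query $q'$ it asks at most one weighted selective degree query and at most one additional query of the same type as $q'$ on $G_{u,v}$ and no others; and for every adaptive randomized query procedure, the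 law of its result when its queries are answered in this way equals the law of its result on $G'_{u,v}$. Let $0\le\alpha$, let $\mathfrak B_=$ be a local algorithm that provides an $(\alpha,\varepsilon)$-estimate in the equal-degree case with probability at least $p$, and let $\mathfrak B_<$ be the algorithm that runs $\mathfrak B_=$ on $G'_{u,v}$, lets the procedure answer the queries, and returns the result of $\mathfrak B_=$ minus the known number $\frac{(3-c)\,b}{\deg_G(v)+1}$. With access to $G_{u,v}$, with probability at least $p$: (b) $\mathfrak B_<$ provides an $(\alpha,\varepsilon)$-estimate of $\mathfrak C_G(e)$ if $\deg_G(v)+1$ is an integral multiple of $\deg_G(u)+1$; (c) if $c=0$ or $\alpha\le 1$, then for every $\delta>0$, $\mathfrak B_<$ provides an $(\alpha,\varepsilon+\delta)$-estimate of $\mathfrak C_G(e)$ if $\deg_G(u)\le\frac{\delta}{3}\deg_G(v)$ or $\deg_G(u)\ge(1-\frac{\delta}{3})\deg_G(v)$. In particular (taking $c=0$), for every $\alpha\ge0$ and every such $\mathfrak B_=$ there is an algorithm $\mathfrak B_<$ with all of (a), (b), (c). -/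

import Mathlib

open scoped ENNReal

noncomputable section

namespace LocalCurvature

/-! ## Earth mover's distance and Ollivier-Ricci curvature -/

/-- The feasible solutions `z` of the transportation linear program with marginals `P` and `Q`. -/
def transportPlans {A B : Type} [Fintype A] [Fintype B] (P : A → ℝ) (Q : B → ℝ) :
    Set (A → B → ℝ) :=
  {z | (∀ x, ∑ y, z x y = P x) ∧ (∀ y, ∑ x, z x y = Q y) ∧ ∀ x y, 0 ≤ z x y}

/-- Earth mover's distance over the complete bipartite graph with edge weights `w`: the optimal
value of the transportation linear program. -/
def emd {A B : Type} [Fintype A] [Fintype B] (w : A → B → ℕ) (P : A → ℝ) (Q : B → ℝ) : ℝ :=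
  sInf ((fun z : A → B → ℝ => ∑ x, ∑ y, (w x y : ℝ) * z x y) '' transportPlans P Q)

/-- The closed neighbourhood `{u} ∪ Nbr(u)`. -/
def closedNbr {V : Type} [Fintype V] [DecidableEq V] (G : SimpleGraph V) [DecidableRel G.Adj]
    (u : V) : Finset V :=
  insert u (G.neighborFinset u)

/-- The edge weights of the complete bipartite graph `G_{u,v}`, whose sides are the closed
neighbourhoods of `u` and `v`: graph distances in `G`. The two sides are regarded as disjoint;
a vertex of `G` in both closed neighbourhoods gives one left node and one right node. -/
def distWeight {V : Type} [Fintype V] [DecidableEq V] (G : SimpleGraph V) [DecidableRel G.Adj]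
    (u v : V) (x : closedNbr G u) (y : closedNbr G v) : ℕ :=
  G.dist x.1 y.1

/-- The Ollivier-Ricci curvature of the edge `{u,v}`. -/
def edgeCurvature {V : Type} [Fintype V] [DecidableEq V] (G : SimpleGraph V) [DecidableRel G.Adj]
    (u v : V) : ℝ :=
  1 - emd (distWeight G u v) (fun _ => 1 / (1 + (G.degree u : ℝ)))
    (fun _ => 1 / (1 + (G.degree v : ℝ)))

/-- `1 - EMD` of the two uniform distributions on the sides of a weighted complete bipartite
graph. -/
def bipartiteCurvature {A B : Type} [Fintype A] [Fintype B] (w : A → B → ℕ) : ℝ :=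
  1 - emd w (fun _ => 1 / (Fintype.card A : ℝ)) (fun _ => 1 / (Fintype.card B : ℝ))

/-- `γ` is an `(α,ε)`-estimate of the curvature `K`: the underlying minimization problem has
optimum `OPT = 1 - K`, and its value `β = 1 - γ` satisfies `OPT ≤ β ≤ α OPT + ε`. -/
def IsEstimateOf (α ε K γ : ℝ) : Prop :=
  1 - K ≤ 1 - γ ∧ 1 - γ ≤ α * (1 - K) + ε

/-! ## Queries -/

/-- The three query types. -/
inductive QueryKind : Type
  | pair
  | neighbor
  | degree

/-- Queries to a weighted complete bipartite graph with left nodes `A` and right nodes `B`. -/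
inductive Query (A B : Type) : Type
  /-- Weighted node-pair query: the weight of the edge `{x,y}`. -/
  | pair (x : A) (y : B)
  /-- Weighted neighbor query: a random not-yet-explored node joined to `z` by weight `s`. -/
  | neighbor (z : A ⊕ B) (s : ℕ)
  /-- Weighted selective degree query: the number of edges of weight `s` at `z`. -/
  | degree (z : A ⊕ B) (s : ℕ)

/-- Type of a query. -/
def Query.kind {A B : Type} : Query A B → QueryKind
  | .pair _ _ => .pair
  | .neighbor _ _ => .neighbor
  | .degree _ _ => .degree

/-- Answers to queries; `node none` is the special symbol "no such node". -/
inductive Answer (A B : Type) : Type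
  | weight (k : ℕ)
  | node (z : Option (A ⊕ B))
  | count (k : ℕ)

/-- The weight of the edge between two nodes, if they are on opposite sides. -/
def edgeWeight {A B : Type} (w : A → B → ℕ) : A ⊕ B → A ⊕ B → Option ℕ
  | .inl x, .inr y => some (w x y)
  | .inr y, .inl x => some (w x y)
  | .inl _, .inl _ => none
  | .inr _, .inr _ => none

/-- The nodes joined to `z` by an edge of weight `s`. -/
def weightNbrs {A B : Type} [Fintype A] [Fintype B] (w : A → B → ℕ) (z : A ⊕ B) (s : ℕ) :
    Finset (A ⊕ B) :=
  Finset.univ.filter (fun z' => edgeWeight w z z' = some s)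

/-- `E z s` is the set of nodes that the neighbor queries `(z,s)` have returned so far. -/
abbrev Explored (A B : Type) : Type := A ⊕ B → ℕ → Set (A ⊕ B)

/-- The explored nodes after query `q` has received answer `r`. -/
def Explored.update {A B : Type} (E : Explored A B) (q : Query A B) (r : Answer A B) :
    Explored A B :=
  fun z s => E z s ∪ {z' | q = .neighbor z s ∧ r = .node (some z')}

open Classical in
/-- The nodes joined to `z` by weight `s` that the query `(z,s)` has not yet returned. -/
def freshNbrs {A B : Type} [Fintype A] [Fintype B] (w : A → B → ℕ) (E : Explored A B)
    (z : A ⊕ B) (s : ℕ) : Finset (A ⊕ B) :=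
  (weightNbrs w z s).filter (fun z' => z' ∉ E z s)

open Classical in
/-- The law of the answer to a query. -/
def answerLaw {A B : Type} [Fintype A] [Fintype B] (w : A → B → ℕ) (E : Explored A B) :
    Query A B → PMF (Answer A B)
  | .pair x y => PMF.pure (.weight (w x y))
  | .neighbor z s =>
      if h : (freshNbrs w E z s).Nonempty then
        (PMF.uniformOfFinset (freshNbrs w E z s) h).map (fun z' => .node (some z'))
      else PMF.pure (.node none)
  | .degree z s => PMF.pure (.count (weightNbrs w z s).card)

/-! ## Query algorithms -/

/-- A randomized adaptive query procedure with results in `O`: it stops with a result, or tosses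
a (discrete) coin, or asks a query; how it goes on may depend on the outcome. -/
inductive QueryTree (A B O : Type) : Type
  | out (o : O)
  | toss (μ : PMF ℕ) (k : ℕ → QueryTree A B O)
  | ask (q : Query A B) (k : Answer A B → QueryTree A B O)

namespace QueryTree

/-- The law of the result on the weighted graph `w`, when the nodes `E` are already explored. -/
def lawFrom {A B O : Type} [Fintype A] [Fintype B] (w : A → B → ℕ) :
    QueryTree A B O → Explored A B → PMF O
  | .out o, _ => PMF.pure o
  | .toss μ k, E => μ.bind (fun i => lawFrom w (k i) E)
  | .ask q k, E => (answerLaw w E q).bind (fun r => lawFrom w (k r) (E.update q r))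

/-- The law of the result on the weighted graph `w`. -/
def law {A B O : Type} [Fintype A] [Fintype B] (w : A → B → ℕ) (t : QueryTree A B O) : PMF O :=
  t.lawFrom w (fun _ _ => ∅)

/-- Run `t`, then continue with a procedure that depends on its result. -/
def bind {A B O O' : Type} : QueryTree A B O → (O → QueryTree A B O') → QueryTree A B O'
  | .out o, f => f o
  | .toss μ k, f => .toss μ (fun i => (k i).bind f)
  | .ask q k, f => .ask q (fun r => (k r).bind f)

/-- Apply a function to the result. -/
def map {A B O O' : Type} (f : O → O') (t : QueryTree A B O) : QueryTree A B O' :=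
  t.bind (fun o => .out (f o))

open Classical in
/-- On every branch, `t` asks at most `m κ` queries of each type `κ`. -/
def AtMost {A B O : Type} : QueryTree A B O → (QueryKind → ℕ) → Prop
  | .out _, _ => True
  | .toss _ k, m => ∀ i, (k i).AtMost m
  | .ask q k, m =>
      0 < m q.kind ∧ ∀ r, (k r).AtMost (Function.update m q.kind (m q.kind - 1))

end QueryTree

/-- A local algorithm for the curvature. It is given the two lists of nodes, hence also knows which
left node and which right node coincide (the relation `A → B → Prop`; these are the edges
of weight `0`), but it learns about all other weights only through queries. -/
abbrev LocalAlgorithm : Type 1 :=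
  ∀ (A B : Type) [Fintype A] [Fintype B], (A → B → Prop) → QueryTree A B ℝ

/-- With probability at least `p`, `𝔅` returns an `(α,ε)`-estimate for the equal-degree
case, i.e. for every complete bipartite graph with equally many nodes on both sides and
edge weights in `{0,1,2,3}`. -/
def EstimatesEqualDegree (𝔅 : LocalAlgorithm) (α ε : ℝ) (p : ℝ≥0∞) : Prop :=
  ∀ (A B : Type) [Fintype A] [Fintype B] [Nonempty A], Fintype.card A = Fintype.card B →
    ∀ w : A → B → ℕ, (∀ x y, w x y ≤ 3) →
      p ≤ ((𝔅 A B (fun x y => w x y = 0)).law w).toOuterMeasure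
        {γ | IsEstimateOf α ε (bipartiteCurvature w) γ}

/-- With probability at least `p`, `𝔅` with query access to `G_{u,v}` returns an
`(α,ε)`-estimate of the curvature of the edge `{u,v}` of `G`. -/
def EstimatesEdge {V : Type} [Fintype V] [DecidableEq V] (G : SimpleGraph V) [DecidableRel G.Adj]
    (u v : V) (𝔅 : LocalAlgorithm) (α ε : ℝ) (p : ℝ≥0∞) : Prop :=
  p ≤ ((𝔅 (closedNbr G u) (closedNbr G v) (fun x y => x.1 = y.1)).law
      (distWeight G u v)).toOuterMeasure
    {γ | IsEstimateOf α ε (edgeCurvature G u v) γ}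

/-! ## The reduction -/

/-- With `|B| = a |A| + b` and `0 ≤ b < |A|`: `a` copies of every node of `A` and `b` special
nodes. -/
abbrev LeftCopies (A B : Type) [Fintype A] [Fintype B] : Type :=
  (A × Fin (Fintype.card B / Fintype.card A)) ⊕ Fin (Fintype.card B % Fintype.card A)

/-- The balanced graph of the reduction: copies inherit the weights of the original
nodes, and all edges at special nodes have weight `c`. -/
def reducedWeight {A B : Type} [Fintype A] [Fintype B] (c : ℕ) (w : A → B → ℕ) :
    LeftCopies A B → B → ℕ
  | .inl x, y => w x.1 y
  | .inr _, _ => c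

/-- The edges of weight `0` of the reduced graph, given those of the original graph. -/
def reducedZero {A B : Type} [Fintype A] [Fintype B] (c : ℕ) (Z : A → B → Prop) :
    LeftCopies A B → B → Prop
  | .inl x, y => Z x.1 y
  | .inr _, _ => c = 0

/-- A procedure that answers, one at a time, queries on a graph with sides `A'`, `B'` by means of
coin tosses and queries on a graph with sides `A`, `B`, and has a memory. -/
structure Simulator (A B A' B' : Type) where
  /-- The possible contents of the memory. -/
  Memory : Type
  /-- The initial memory. -/
  start : Memory
  /-- How a query is answered. -/
  answer : Memory → Query A' B' → QueryTree A B (Memory × Answer A' B')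

/-- Run a query procedure, letting the simulator `S` with memory `σ` answer its queries. -/
def Simulator.runFrom {A B A' B' O : Type} (S : Simulator A B A' B') :
    QueryTree A' B' O → S.Memory → QueryTree A B O
  | .out o, _ => .out o
  | .toss μ k, σ => .toss μ (fun i => S.runFrom (k i) σ)
  | .ask q k, σ => (S.answer σ q).bind (fun a => S.runFrom (k a.2) a.1)

/-- Run a query procedure, letting the simulator `S` answer its queries. -/
def Simulator.run {A B A' B' O : Type} (S : Simulator A B A' B') (t : QueryTree A' B' O) :
    QueryTree A B O :=
  S.runFrom t S.start

open Classical in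
/-- One degree query plus one query of type `κ`. -/
def simulationBudget (κ : QueryKind) : QueryKind → ℕ :=
  fun κ' => (if κ' = .degree then 1 else 0) + (if κ' = κ then 1 else 0)

/-- The algorithm that runs `𝔅` on the reduced graph, the simulators `S` answering the queries, and
adds to the resulting estimate of the earth mover's distance the known number `(3 - c) b / |B|`
(no change if `c = 3` or `b = 0`). -/
def localized (c : ℕ)
    (S : ∀ (A B : Type) [Fintype A] [Fintype B],
      (A → B → Prop) → Simulator A B (LeftCopies A B) B)
    (𝔅 : LocalAlgorithm) : LocalAlgorithm :=
  fun A B _ _ Z =>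
    ((S A B Z).run (𝔅 (LeftCopies A B) B (reducedZero c Z))).map
      (fun γ => γ - (3 - (c : ℝ)) * ((Fintype.card B % Fintype.card A : ℕ) : ℝ)
        / (Fintype.card B : ℝ))

end LocalCurvature

end

/-! Write m = |A|, n = |B| = am + b, and let OPT, OPT' be the optima on the original and the reduced
graph. Two explicit plans compare them. Merging the copies and spreading the special mass b/n evenly
over A gives OPT ≤ OPT' + (3-c)b/n (`emd_le_emd_reduced`), since this mass cost c per unit and now
costs at most 3. Scaling a plan by m/n on each copy and letting special nodes ship uniformly gives
OPT' ≤ OPT + cb/n (`emd_reduced_le_emd`). Adding (3-c)b/n to an estimate of OPT' therefore yields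
one of OPT with additional error at most (αc + 3 - c)b/n. This vanishes if b = 0; if c = 0 or α ≤ 1
it is at most 3b/n, which the degree conditions in (c) bound by δ.

For the simulation, pair and degree queries translate directly. The difficulty lies in neighbor
queries: all copies of a node share one stream of answers without repetition in the original graph.
The fresh neighbors in the reduced graph are therefore split into those already known (returned
through another copy, further copies of a returned node, special nodes) and the copies of neighbors
not yet explored in the original graph. A degree query gives the size of the second part, a coin
decides between the parts, and only the second part needs a neighbor query
(`lawFrom_neighborReply`). The invariant is that the explored nodes of the original graph are the
projection `projExplored` of the simulated record; `lawFrom_reply` preserves it together with the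
law of the answer, and induction gives `law_run`. -/

noncomputable section

namespace LocalCurvature

/-! ## Earth mover's distance of the reduced graph -/

section EMD

variable {A B : Type} [Fintype A] [Fintype B]

/-- The cost of a transport plan. -/
def planCost (w : A → B → ℕ) (z : A → B → ℝ) : ℝ := ∑ x, ∑ y, (w x y : ℝ) * z x y

lemma planCost_nonneg (w : A → B → ℕ) {z : A → B → ℝ} (hz : ∀ x y, 0 ≤ z x y) :
    0 ≤ planCost w z :=
  Finset.sum_nonneg fun x _ => Finset.sum_nonneg fun y _ => mul_nonneg (Nat.cast_nonneg _) (hz x y)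

lemma emd_le_planCost (w : A → B → ℕ) {P : A → ℝ} {Q : B → ℝ} {z : A → B → ℝ}
    (hz : z ∈ transportPlans P Q) : emd w P Q ≤ planCost w z :=
  csInf_le ⟨0, by rintro _ ⟨z, hz, rfl⟩; exact planCost_nonneg w hz.2.2⟩ ⟨z, hz, rfl⟩

/-- The product plan serves only to show feasibility: the real `sInf` of the empty set is 0, so
lower bounds on `emd` need a plan to exist. -/
lemma uniform_mem_transportPlans [Nonempty A] [Nonempty B] :
    (fun _ _ => 1 / ((Fintype.card A : ℝ) * Fintype.card B)) ∈
      transportPlans (fun _ : A => 1 / (Fintype.card A : ℝ))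
        (fun _ : B => 1 / (Fintype.card B : ℝ)) := by
  have hA : (Fintype.card A : ℝ) ≠ 0 := by simp
  have hB : (Fintype.card B : ℝ) ≠ 0 := by simp
  refine ⟨fun x => ?_, fun y => ?_, fun x y => by positivity⟩ <;>
  · simp only [Finset.sum_const, Finset.card_univ, nsmul_eq_mul]
    field_simp

lemma le_emd_uniform [Nonempty A] [Nonempty B] (w : A → B → ℕ) {r : ℝ}
    (h : ∀ z ∈ transportPlans (fun _ : A => 1 / (Fintype.card A : ℝ))
      (fun _ : B => 1 / (Fintype.card B : ℝ)), r ≤ planCost w z) :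
    r ≤ emd w (fun _ => 1 / (Fintype.card A : ℝ)) (fun _ => 1 / (Fintype.card B : ℝ)) :=
  le_csInf ⟨_, _, uniform_mem_transportPlans, rfl⟩ (by rintro _ ⟨z, hz, rfl⟩; exact h z hz)

lemma card_leftCopies : Fintype.card (LeftCopies A B) = Fintype.card B := by
  simp only [LeftCopies, Fintype.card_sum, Fintype.card_prod, Fintype.card_fin]
  exact Nat.div_add_mod _ _

lemma planCost_reducedWeight (c : ℕ) (w : A → B → ℕ) (z : LeftCopies A B → B → ℝ) :
    planCost (reducedWeight c w) z =
      (∑ x, ∑ y, (w x y : ℝ) * ∑ i, z (.inl (x, i)) y) + c * ∑ j, ∑ y, z (.inr j) y := by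
  simp only [planCost, Fintype.sum_sum_type, Fintype.sum_prod_type, reducedWeight,
    Finset.mul_sum]
  congr 1
  exact Finset.sum_congr rfl fun x _ => Finset.sum_comm

lemma card_eq_cast : (Fintype.card B : ℝ) =
    Fintype.card A * (Fintype.card B / Fintype.card A : ℕ) +
      (Fintype.card B % Fintype.card A : ℕ) := by
  exact_mod_cast (Nat.div_add_mod _ _).symm

/-- Spreading the mass of the special nodes evenly over the original nodes. -/
lemma emd_le_emd_reduced [Nonempty A] [Nonempty B] (c : ℕ) (w : A → B → ℕ)
    (hw : ∀ x y, w x y ≤ 3) :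
    emd w (fun _ => 1 / (Fintype.card A : ℝ)) (fun _ => 1 / (Fintype.card B : ℝ)) ≤
      emd (reducedWeight c w) (fun _ => 1 / (Fintype.card (LeftCopies A B) : ℝ))
        (fun _ => 1 / (Fintype.card B : ℝ)) +
      (3 - (c : ℝ)) * ((Fintype.card B % Fintype.card A : ℕ) : ℝ) / (Fintype.card B : ℝ) := by
  have : Nonempty (LeftCopies A B) := by
    rw [← Fintype.card_pos_iff, card_leftCopies]; exact Fintype.card_pos
  rw [← sub_le_iff_le_add]
  refine le_emd_uniform _ fun z hz => ?_
  obtain ⟨h1, h2, h3⟩ := hz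
  simp only [card_leftCopies] at h1
  have hA : (Fintype.card A : ℝ) ≠ 0 := by simp
  have hB : (Fintype.card B : ℝ) ≠ 0 := by simp
  have hAB := card_eq_cast (A := A) (B := B)
  have hsp : ∑ j, ∑ y, z (.inr j) y =
      ((Fintype.card B % Fintype.card A : ℕ) : ℝ) / (Fintype.card B : ℝ) := by
    simp only [h1, Finset.sum_const, Finset.card_univ, Fintype.card_fin, nsmul_eq_mul]
    ring
  set n := (Fintype.card B : ℝ)
  set m := (Fintype.card A : ℝ)
  set a := ((Fintype.card B / Fintype.card A : ℕ) : ℝ) with ha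
  set b := ((Fintype.card B % Fintype.card A : ℕ) : ℝ)
  -- The copies of x ship a/n in total, and the share b/(mn) of the special mass completes this to
  -- 1/m because am + b = n.
  have hmem : (fun x y => ∑ i, z (.inl (x, i)) y + (1 / m) * ∑ j, z (.inr j) y) ∈
      transportPlans (fun _ : A => 1 / m) (fun _ : B => 1 / n) := by
    refine ⟨fun x => ?_, fun y => ?_, fun x y => ?_⟩
    · rw [Finset.sum_add_distrib, ← Finset.mul_sum, Finset.sum_comm,
        Finset.sum_comm (f := fun y j => z (.inr j) y), hsp]
      simp only [h1, Finset.sum_const, Finset.card_univ, Fintype.card_fin, nsmul_eq_mul]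
      rw [← ha]
      field_simp
      rw [hAB]; ring
    · rw [← h2 y, Fintype.sum_sum_type, Fintype.sum_prod_type, Finset.sum_add_distrib]
      simp only [Finset.sum_const, Finset.card_univ, nsmul_eq_mul]
      congr 1
      field_simp
      simp [m]
    · exact add_nonneg (Finset.sum_nonneg fun i _ => h3 _ _)
        (mul_nonneg (by positivity) (Finset.sum_nonneg fun i _ => h3 _ _))
  have hle := emd_le_planCost w hmem
  -- The redistributed mass b/n costs at most 3 per unit, against exactly c per unit in the reduced
  -- plan.
  have hbound : planCost w (fun x y => ∑ i, z (.inl (x, i)) y + (1 / m) * ∑ j, z (.inr j) y) ≤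
      (∑ x, ∑ y, (w x y : ℝ) * ∑ i, z (.inl (x, i)) y) + 3 * (b / n) := by
    simp only [planCost, mul_add, Finset.sum_add_distrib]
    gcongr
    calc ∑ x, ∑ y, (w x y : ℝ) * (1 / m * ∑ j, z (.inr j) y)
        ≤ ∑ x : A, ∑ y, (3 : ℝ) * (1 / m * ∑ j, z (.inr j) y) := by
          refine Finset.sum_le_sum fun x _ => Finset.sum_le_sum fun y _ => ?_
          refine mul_le_mul_of_nonneg_right (by exact_mod_cast hw x y) ?_
          exact mul_nonneg (by positivity) (Finset.sum_nonneg fun i _ => h3 _ _)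
      _ = 3 * (b / n) := by
          simp only [← Finset.mul_sum]
          rw [Finset.sum_comm (f := fun y j => z (.inr j) y), hsp]
          simp only [Finset.sum_const, Finset.card_univ, nsmul_eq_mul]
          field_simp
          simp [m]
  rw [planCost_reducedWeight, hsp]
  linarith [mul_div_assoc (3 - (c : ℝ)) b n, sub_mul 3 (c : ℝ) (b / n)]

/-- Scaling a plan down and letting every special node ship evenly. -/
lemma emd_reduced_le_emd [Nonempty A] [Nonempty B] (c : ℕ) (w : A → B → ℕ) :
    emd (reducedWeight c w) (fun _ => 1 / (Fintype.card (LeftCopies A B) : ℝ))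
        (fun _ => 1 / (Fintype.card B : ℝ)) ≤
      emd w (fun _ => 1 / (Fintype.card A : ℝ)) (fun _ => 1 / (Fintype.card B : ℝ)) +
      (c : ℝ) * ((Fintype.card B % Fintype.card A : ℕ) : ℝ) / (Fintype.card B : ℝ) := by
  rw [← sub_le_iff_le_add]
  refine le_emd_uniform _ fun z hz => ?_
  have hcost := planCost_nonneg w hz.2.2
  obtain ⟨h1, h2, h3⟩ := hz
  have hA : (0 : ℝ) < Fintype.card A := by simp [Fintype.card_pos]
  have hB : (0 : ℝ) < Fintype.card B := by simp [Fintype.card_pos]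
  have hAB := card_eq_cast (A := A) (B := B)
  simp only [card_leftCopies]
  set n := (Fintype.card B : ℝ) with hn
  set m := (Fintype.card A : ℝ)
  set a := ((Fintype.card B / Fintype.card A : ℕ) : ℝ) with ha
  set b := ((Fintype.card B % Fintype.card A : ℕ) : ℝ) with hb
  have hb0 : 0 ≤ b := Nat.cast_nonneg _
  -- The factor m/n turns the row sum 1/m into 1/n; a special node ships 1/n² to each right node.
  -- Column sums are (am + b)/n² = 1/n.
  let z' : LeftCopies A B → B → ℝ :=
    Sum.elim (fun x y => m / n * z x.1 y) (fun _ _ => 1 / n ^ 2)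
  have hmem : z' ∈ transportPlans (fun _ : LeftCopies A B => 1 / n) (fun _ : B => 1 / n) := by
    refine ⟨?_, fun y => ?_, ?_⟩
    · rintro (x | j)
      · simp only [z', Sum.elim_inl, ← Finset.mul_sum, h1]
        field_simp
      · simp only [z', Sum.elim_inr, Finset.sum_const, Finset.card_univ, nsmul_eq_mul, ← hn]
        field_simp
    · simp only [z', Fintype.sum_sum_type, Fintype.sum_prod_type, Sum.elim_inl, Sum.elim_inr,
        Finset.sum_const, Finset.card_univ, nsmul_eq_mul, Fintype.card_fin, ← Finset.mul_sum, h2]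
      rw [← ha, ← hb]
      field_simp
      linarith
    · rintro (x | j) y
      · exact mul_nonneg (by positivity) (h3 _ _)
      · simp only [z', Sum.elim_inr]; positivity
  refine sub_le_iff_le_add.2 ((emd_le_planCost _ hmem).trans ?_)
  rw [planCost_reducedWeight]
  simp only [z', Sum.elim_inl, Sum.elim_inr, Finset.sum_const, Finset.card_univ, nsmul_eq_mul,
    Fintype.card_fin]
  rw [← ha, ← hb, ← hn]
  have e1 : ∑ x, ∑ y, (w x y : ℝ) * (a * (m / n * z x y)) = (a * m / n) * planCost w z := by
    simp only [planCost, Finset.mul_sum]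
    exact Finset.sum_congr rfl fun x _ => Finset.sum_congr rfl fun y _ => by ring
  have e2 : (c : ℝ) * (b * (n * (1 / n ^ 2))) = c * b / n := by field_simp
  -- The copies carry only the fraction am/n ≤ 1 of the original cost, and that cost is nonnegative.
  have e3 : a * m / n ≤ 1 := by rw [div_le_one hB]; linarith
  rw [e1, e2]
  linarith [mul_le_of_le_one_left hcost e3]

end EMD

/-! ## Sampling -/

/-- Agreement on the support is all that is available later: decoding a coin toss and validity of an
updated record hold only there. -/
lemma pmf_bind_congr {α β : Type*} (μ : PMF α) {f g : α → PMF β}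
    (h : ∀ a ∈ μ.support, f a = g a) : μ.bind f = μ.bind g := by
  ext b
  simp only [PMF.bind_apply]
  refine tsum_congr fun a => ?_
  by_cases ha : μ a = 0
  · simp [ha]
  · rw [h a ((PMF.mem_support_iff _ _).2 ha)]

/-- Uniform choice from the disjoint union of `K` and `U × ι`, in two steps. -/
lemma uniformOfFinset_bind_eq {T S ι O : Type} [Fintype T] [Fintype S] [Fintype ι]
    (F K : Finset T) (U : Finset S) (l : S → ι → T) (u : ℕ) (hu : u = U.card)
    (hF : ∀ t, t ∈ F ↔ t ∈ K ∨ ∃ x ∈ U, ∃ i, l x i = t)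
    (hK : ∀ x ∈ U, ∀ i, l x i ∉ K)
    (hl : ∀ x ∈ U, ∀ x' ∈ U, ∀ i i', l x i = l x' i' → x = x' ∧ i = i')
    (hne : F.Nonempty) [Nonempty (K ⊕ (Fin u × ι))] (h : T → PMF O) :
    (PMF.uniformOfFinset F hne).bind h =
      (PMF.uniformOfFintype (K ⊕ (Fin u × ι))).bind
        (Sum.elim (fun t => h t) (fun p => (PMF.uniformOfFinset U
          (Finset.card_pos.1 (hu ▸ p.1.pos))).bind (fun x => h (l x p.2)))) := by
  classical
  have hFeq : F = K.disjUnion ((U ×ˢ Finset.univ).image (fun p => l p.1 p.2)) (by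
      rw [Finset.disjoint_left]
      rintro t ht ht'
      simp only [Finset.mem_image, Finset.mem_product, Finset.mem_univ, and_true,
        Prod.exists] at ht'
      obtain ⟨x, i, hx, rfl⟩ := ht'
      exact hK x hx i ht) := by
    ext t
    simp [hF]
  have hinj : Set.InjOn (fun p : S × ι => l p.1 p.2) (U ×ˢ Finset.univ : Finset (S × ι)) := by
    rintro ⟨x, i⟩ hx ⟨x', i'⟩ hx' he
    simp only [Finset.coe_product, Finset.coe_univ, Set.mem_prod, Finset.mem_coe, Set.mem_univ,
      and_true] at hx hx'
    obtain ⟨rfl, rfl⟩ := hl x hx x' hx' i i' he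
    rfl
  have hcard : F.card = K.card + u * Fintype.card ι := by
    rw [hFeq, Finset.card_disjUnion, Finset.card_image_of_injOn hinj, Finset.card_product, hu,
      Finset.card_univ]
  ext o
  have hL : ((PMF.uniformOfFinset F hne).bind h) o = ∑ t ∈ F, (F.card : ℝ≥0∞)⁻¹ * h t o := by
    simp only [PMF.bind_apply, PMF.uniformOfFinset_apply, tsum_fintype, ite_mul, zero_mul]
    rw [← Finset.sum_filter]
    exact Finset.sum_congr (by simp) fun _ _ => rfl
  rw [hL, PMF.bind_apply, tsum_fintype, Fintype.sum_sum_type, Fintype.sum_prod_type]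
  simp only [PMF.uniformOfFintype_apply, Fintype.card_sum, Fintype.card_coe, Fintype.card_prod,
    Fintype.card_fin, Sum.elim_inl, Sum.elim_inr, ← hcard, ← Finset.mul_sum, ← mul_add]
  congr 1
  conv_lhs => rw [hFeq]
  rw [Finset.sum_disjUnion, Finset.sum_image hinj, Finset.sum_product_right]
  congr 1
  · exact (Finset.sum_coe_sort K (fun t => h t o)).symm
  · refine Eq.trans ?_ Finset.sum_comm
    refine Finset.sum_congr rfl fun i _ => ?_
    have hU : ∀ j : Fin u, ((PMF.uniformOfFinset U
        (Finset.card_pos.1 (hu ▸ j.pos))).bind (fun x => h (l x i))) o =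
          (u : ℝ≥0∞)⁻¹ * ∑ x ∈ U, h (l x i) o := by
      intro j
      simp only [PMF.bind_apply, PMF.uniformOfFinset_apply, tsum_fintype, ite_mul, zero_mul]
      rw [← Finset.sum_filter, hu, Finset.mul_sum]
      exact Finset.sum_congr (by simp) fun _ _ => rfl
    rw [Finset.sum_congr rfl fun j _ => hU j]
    simp only [Finset.sum_const, Finset.card_univ, Fintype.card_fin, nsmul_eq_mul]
    rcases Nat.eq_zero_or_pos u with h0 | h0
    · have : U = ∅ := Finset.card_eq_zero.1 (by omega)
      simp [this]
    · rw [← mul_assoc, ENNReal.mul_inv_cancel (by simpa using h0.ne') (by simp), one_mul]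

/-! ### Coin tosses, budgets and laws of query trees -/

namespace QueryTree

variable {A B O O' O'' : Type}

/-- Draw from a discrete law by one coin toss. -/
def sample {α : Type} (μ : PMF α) (k : α → QueryTree A B O) : QueryTree A B O :=
  haveI : Nonempty α := ⟨μ.support_nonempty.some⟩
  .toss (μ.map (Classical.choose (Set.countable_iff_exists_injOn.1 μ.support_countable)))
    (fun i => k (Function.invFunOn (Classical.choose (Set.countable_iff_exists_injOn.1 μ.support_countable))
      μ.support i))

lemma bind_sample {α : Type} (μ : PMF α) (k : α → QueryTree A B O) (f : O → QueryTree A B O') :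
    (sample μ k).bind f = sample μ (fun a => (k a).bind f) := rfl

lemma AtMost.sample {α : Type} {μ : PMF α} {k : α → QueryTree A B O} {m : QueryKind → ℕ}
    (h : ∀ a, (k a).AtMost m) : (sample μ k).AtMost m := fun _ => h _

lemma AtMost.map {t : QueryTree A B O} {f : O → O'} {m : QueryKind → ℕ} (h : t.AtMost m) :
    (t.map f).AtMost m := by
  induction t generalizing m with
  | out o => trivial
  | toss μ k ih => exact fun i => ih i (h i)
  | ask q k ih => exact ⟨h.1, fun r => ih r (h.2 r)⟩

lemma bind_map (t : QueryTree A B O) (f : O → O') (g : O' → QueryTree A B O'') :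
    (t.map f).bind g = t.bind (fun o => g (f o)) := by
  induction t with
  | out o => rfl
  | toss μ k ih => exact congrArg (QueryTree.toss μ) (funext ih)
  | ask q k ih => exact congrArg (QueryTree.ask q) (funext ih)

variable [Fintype A] [Fintype B]

lemma lawFrom_sample (w : A → B → ℕ) {α : Type} (μ : PMF α) (k : α → QueryTree A B O)
    (E : Explored A B) :
    (sample μ k).lawFrom w E = μ.bind (fun a => (k a).lawFrom w E) := by
  rw [sample, lawFrom, PMF.bind_map]
  -- `toss` yields natural numbers, so outcomes are encoded by an injection of the countable support
  -- into ℕ; its inverse is correct on the support only.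
  refine pmf_bind_congr _ fun a ha => ?_
  have : Nonempty α := ⟨a⟩
  have := (Classical.choose_spec (Set.countable_iff_exists_injOn.1 μ.support_countable))
  simp only [Function.comp]
  rw [this.leftInvOn_invFunOn ha]

lemma lawFrom_map (w : A → B → ℕ) (t : QueryTree A B O) (f : O → O') (E : Explored A B) :
    (t.map f).lawFrom w E = (t.lawFrom w E).map f := by
  induction t generalizing E with
  | out o => exact (PMF.pure_map f o).symm
  | toss μ k ih =>
    change μ.bind (fun i => ((k i).map f).lawFrom w E) = (μ.bind _).map f
    rw [PMF.map_bind]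
    simp only [ih]
  | ask q k ih =>
    change (answerLaw w E q).bind (fun r => ((k r).map f).lawFrom w (E.update q r)) =
      ((answerLaw w E q).bind _).map f
    rw [PMF.map_bind]
    simp only [ih]

end QueryTree

/-! ## Answering queries on the reduced graph -/

lemma Explored.update_of_ne {A B : Type} (E : Explored A B) {q : Query A B} {r : Answer A B}
    (h : ∀ z s z', ¬ (q = .neighbor z s ∧ r = .node (some z'))) : E.update q r = E := by
  funext z s
  simp [Explored.update, h]

section Basic

variable {A B : Type} (w : A → B → ℕ) (x x' : A) (y y' : B)

@[simp] lemma edgeWeight_inl_inr : edgeWeight w (.inl x) (.inr y) = some (w x y) := rfl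
@[simp] lemma edgeWeight_inr_inl : edgeWeight w (.inr y) (.inl x) = some (w x y) := rfl
@[simp] lemma edgeWeight_inl_inl : edgeWeight w (.inl x) (.inl x') = none := rfl
@[simp] lemma edgeWeight_inr_inr : edgeWeight w (.inr y) (.inr y') = none := rfl

variable [Fintype A] [Fintype B]

@[simp] lemma reducedWeight_inl (c : ℕ) (w : A → B → ℕ)
    (x : A × Fin (Fintype.card B / Fintype.card A)) (y : B) :
    reducedWeight c w (.inl x) y = w x.1 y := rfl

@[simp] lemma reducedWeight_inr (c : ℕ) (w : A → B → ℕ)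
    (j : Fin (Fintype.card B % Fintype.card A)) (y : B) :
    reducedWeight c w (.inr j) y = c := rfl

variable {w}

@[simp] lemma mem_weightNbrs {z t : A ⊕ B} {s : ℕ} :
    t ∈ weightNbrs w z s ↔ edgeWeight w z t = some s := by
  simp [weightNbrs]

@[simp] lemma mem_freshNbrs {E : Explored A B} {z t : A ⊕ B} {s : ℕ} :
    t ∈ freshNbrs w E z s ↔ edgeWeight w z t = some s ∧ t ∉ E z s := by
  simp [freshNbrs]

lemma card_weightNbrs (z : A ⊕ B) (s : ℕ) :
    (weightNbrs w z s).card = ∑ t, if edgeWeight w z t = some s then 1 else 0 :=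
  Finset.card_filter _ _

end Basic

/-! ### Simulating one neighbor query by a degree query and a neighbor query -/

section Fresh

variable {A B A' B' ι O : Type} [Fintype ι]

open Classical in
/-- The number of nodes joined to `z` by weight `s` that are still to be explored, when there
are `d` such nodes in total. -/
def unexploredCount [Fintype A] [Fintype B] (E : Explored A B) (z : A ⊕ B) (s d : ℕ) : ℕ :=
  d - (Finset.univ.filter (fun x => x ∈ E z s)).card

open Classical in
/-- Answer with a uniformly random element of `K` and of the `u` unexplored weight-`s`
neighbors of `z`, each of them counted once for every `i : ι`; its copy number `i` is `l x i`. -/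
def freshReply (z : A ⊕ B) (s : ℕ) (l : A ⊕ B → ι → A' ⊕ B') (K : Finset (A' ⊕ B')) (u : ℕ) :
    QueryTree A B (Answer A' B') :=
  if _h : Nonempty (K ⊕ (Fin u × ι)) then
    .sample (PMF.uniformOfFintype (K ⊕ (Fin u × ι))) (Sum.elim
      (fun t => .out (.node (some t)))
      (fun p => .ask (.neighbor z s) (fun r => .out (match r with
        | .node (some x) => .node (some (l x p.2))
        | _ => .node none))))
  else .out (.node none)

/-- Answer a neighbor query by one degree query and at most one neighbor query. -/
def neighborReply [Fintype A] [Fintype B] (E : Explored A B) (z : A ⊕ B) (s : ℕ)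
    (l : A ⊕ B → ι → A' ⊕ B') (K : Finset (A' ⊕ B')) : QueryTree A B (Answer A' B') :=
  .ask (.degree z s) (fun r => match r with
    | .count d => freshReply z s l K (unexploredCount E z s d)
    | _ => .out (.node none))

lemma atMost_freshReply (z : A ⊕ B) (s : ℕ) (l : A ⊕ B → ι → A' ⊕ B') (K : Finset (A' ⊕ B'))
    (u : ℕ) {m : QueryKind → ℕ} (hm : 0 < m .neighbor) : (freshReply z s l K u).AtMost m := by
  unfold freshReply
  split_ifs
  · refine QueryTree.AtMost.sample ?_
    rintro (t | p)
    · trivial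
    · exact ⟨hm, fun _ => trivial⟩
  · trivial

lemma atMost_neighborReply [Fintype A] [Fintype B] (E : Explored A B) (z : A ⊕ B) (s : ℕ)
    (l : A ⊕ B → ι → A' ⊕ B') (K : Finset (A' ⊕ B')) :
    (neighborReply E z s l K).AtMost (simulationBudget .neighbor) := by
  refine ⟨by simp [simulationBudget, Query.kind], fun r => ?_⟩
  rcases r with d | d | d
  · trivial
  · trivial
  · exact atMost_freshReply _ _ _ _ _ (by simp [simulationBudget, Query.kind, Function.update])

variable [Fintype A] [Fintype B]

/-- Returned nodes are true neighbors, so the subtraction does not truncate and degree minus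
explored counts the fresh nodes exactly. -/
lemma unexploredCount_eq (w : A → B → ℕ) (E : Explored A B) (z : A ⊕ B) (s : ℕ)
    (hE : ∀ x ∈ E z s, x ∈ weightNbrs w z s) :
    unexploredCount E z s (weightNbrs w z s).card = (freshNbrs w E z s).card := by
  classical
  have h1 : freshNbrs w E z s = weightNbrs w z s \ Finset.univ.filter (fun x => x ∈ E z s) := by
    ext x; simp [freshNbrs]
  rw [h1, Finset.card_sdiff_of_subset (fun x hx => hE x (by simpa using hx)), unexploredCount]

variable [Fintype A'] [Fintype B']

/-- The answer is distributed as on the simulated graph, jointly with the nodes explored. -/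
lemma lawFrom_neighborReply (w : A → B → ℕ) (w' : A' → B' → ℕ) (E : Explored A B)
    (E' : Explored A' B') (z : A ⊕ B) (z' : A' ⊕ B') (s : ℕ) (l : A ⊕ B → ι → A' ⊕ B')
    (K : Finset (A' ⊕ B')) (X : Answer A' B' → Explored A B)
    (hE : ∀ x ∈ E z s, x ∈ weightNbrs w z s)
    (hF : ∀ t, t ∈ freshNbrs w' E' z' s ↔ t ∈ K ∨ ∃ x ∈ freshNbrs w E z s, ∃ i, l x i = t)
    (hK : ∀ x ∈ freshNbrs w E z s, ∀ i, l x i ∉ K)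
    (hl : ∀ x ∈ freshNbrs w E z s, ∀ x' ∈ freshNbrs w E z s, ∀ i i',
      l x i = l x' i' → x = x' ∧ i = i')
    (hXnone : X (.node none) = E) (hXK : ∀ t ∈ K, X (.node (some t)) = E)
    (hXl : ∀ x ∈ freshNbrs w E z s, ∀ i,
      X (.node (some (l x i))) = E.update (.neighbor z s) (.node (some x)))
    (f : Answer A' B' → QueryTree A B O) :
    ((neighborReply E z s l K).bind f).lawFrom w E =
      (answerLaw w' E' (.neighbor z' s)).bind (fun r => (f r).lawFrom w (X r)) := by
  have hu := unexploredCount_eq w E z s hE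
  have h0 : ((neighborReply E z s l K).bind f).lawFrom w E =
      ((freshReply z s l K (unexploredCount E z s (weightNbrs w z s).card)).bind f).lawFrom w
        (E.update (.degree z s) (.count (weightNbrs w z s).card)) := by
    simp only [neighborReply, QueryTree.bind, QueryTree.lawFrom, answerLaw, PMF.pure_bind]
  rw [h0, Explored.update_of_ne E (by simp)]
  generalize unexploredCount E z s (weightNbrs w z s).card = u at hu
  -- The test made in `freshReply`, which uses only `K` and the count, detects whether the simulated
  -- query has anything left to return.
  have hiff : Nonempty (K ⊕ (Fin u × ι)) ↔ (freshNbrs w' E' z' s).Nonempty := by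
    constructor
    · rintro ⟨t | ⟨j, i⟩⟩
      · exact ⟨t, (hF _).2 (.inl t.2)⟩
      · obtain ⟨x, hx⟩ := Finset.card_pos.1 (hu ▸ j.pos)
        exact ⟨l x i, (hF _).2 (.inr ⟨x, hx, i, rfl⟩)⟩
    · rintro ⟨t, ht⟩
      rcases (hF t).1 ht with h | ⟨x, hx, i, -⟩
      · exact ⟨.inl ⟨t, h⟩⟩
      · exact ⟨.inr (⟨0, by rw [hu]; exact Finset.card_pos.2 ⟨x, hx⟩⟩, i)⟩
  by_cases hne : (freshNbrs w' E' z' s).Nonempty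
  · have hne' := hiff.2 hne
    simp only [answerLaw, dif_pos hne, freshReply, dif_pos hne', PMF.bind_map,
      QueryTree.bind_sample, QueryTree.lawFrom_sample]
    rw [uniformOfFinset_bind_eq _ K _ l u hu hF hK hl hne]
    refine congrArg _ (funext ?_)
    rintro (t | p)
    · simp only [Sum.elim_inl, QueryTree.bind, Function.comp, hXK t t.2]
    · have hne2 : (freshNbrs w E z s).Nonempty := Finset.card_pos.1 (hu ▸ p.1.pos)
      simp only [Sum.elim_inr, QueryTree.bind, Function.comp, QueryTree.lawFrom, answerLaw,
        dif_pos hne2, PMF.bind_map]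
      -- The original answer x is fresh, hence recording its copy has the same effect as recording x
      -- itself.
      refine pmf_bind_congr _ fun x hx => ?_
      simp only [Function.comp]
      rw [hXl x (by simpa using hx)]
  · have hne' := mt hiff.1 hne
    simp only [answerLaw, dif_neg hne, freshReply, dif_neg hne', PMF.pure_bind, QueryTree.bind,
      hXnone]

end Fresh

/-! ### The simulator and the exactness of its answers -/

section Simulator

variable {A B : Type} [Fintype A] [Fintype B]

/-- The nodes of the original graph that have been explored, in terms of the reduced graph. -/
def projExplored (E : Explored (LeftCopies A B) B) : Explored A B
  | .inl x, s => {t | ∃ y i, t = .inr y ∧ .inr y ∈ E (.inl (.inl (x, i))) s}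
  | .inr y, s => {t | ∃ x i, t = .inl x ∧ .inl (.inl (x, i)) ∈ E (.inr y) s}

/-- `t` is known to be a weight-`s` neighbor of `z` in the reduced graph. -/
def IsKnown (c : ℕ) (E : Explored (LeftCopies A B) B) :
    LeftCopies A B ⊕ B → ℕ → LeftCopies A B ⊕ B → Prop
  | .inl (.inl (x, _)), s, .inr y => .inr y ∈ projExplored E (.inl x) s
  | .inr y, s, .inl (.inl (x, _)) => .inl x ∈ projExplored E (.inr y) s
  | .inr _, s, .inl (.inr _) => s = c
  | _, _, _ => False

open Classical in
/-- The known weight-`s` neighbors of `z` that the query `(z,s)` has not yet returned. -/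
def knownFresh (c : ℕ) (E : Explored (LeftCopies A B) B) (z : LeftCopies A B ⊕ B) (s : ℕ) :
    Finset (LeftCopies A B ⊕ B) :=
  Finset.univ.filter (fun t => t ∉ E z s ∧ IsKnown c E z s t)

@[simp] lemma mem_knownFresh {c : ℕ} {E : Explored (LeftCopies A B) B} {z t : LeftCopies A B ⊕ B}
    {s : ℕ} : t ∈ knownFresh c E z s ↔ t ∉ E z s ∧ IsKnown c E z s t := by
  simp [knownFresh]

/-- Right nodes have one copy. -/
def liftRight (z : LeftCopies A B ⊕ B) : A ⊕ B → Unit → LeftCopies A B ⊕ B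
  -- Junk value: neighbors of a left node are right nodes. `liftLeft` has the mirror-image default.
  | .inl _, _ => z
  | .inr y, _ => .inr y

/-- The copies of left nodes. -/
def liftLeft (z : LeftCopies A B ⊕ B) :
    A ⊕ B → Fin (Fintype.card B / Fintype.card A) → LeftCopies A B ⊕ B
  | .inl x, i => .inl (.inl (x, i))
  | .inr _, _ => z

/-- How a query on the reduced graph is answered. Queries at special nodes need no query
on the original graph. -/
def reply (c : ℕ) (E : Explored (LeftCopies A B) B) :
    Query (LeftCopies A B) B → QueryTree A B (Answer (LeftCopies A B) B)
  | .pair (.inl (x, _)) y => .ask (.pair x y) (fun r => .out (match r with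
      | .weight k => .weight k
      | _ => .node none))
  | .degree (.inl (.inl (x, _))) s => .ask (.degree (.inl x) s) (fun r => .out (match r with
      | .count d => .count d
      | _ => .node none))
  | .degree (.inr y) s => .ask (.degree (.inr y) s) (fun r => .out (match r with
      | .count d => .count (d * (Fintype.card B / Fintype.card A) +
          if s = c then Fintype.card B % Fintype.card A else 0)
      | _ => .node none))
  | .neighbor (.inl (.inl (x, i))) s =>
      neighborReply (projExplored E) (.inl x) s (liftRight (.inl (.inl (x, i))))
        (knownFresh c E (.inl (.inl (x, i))) s)
  | .neighbor (.inr y) s =>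
      neighborReply (projExplored E) (.inr y) s (liftLeft (.inr y)) (knownFresh c E (.inr y) s)
  | .pair (.inr j) y => .sample (answerLaw (reducedWeight c (fun (_ : A) (_ : B) => 0)) E
      (.pair (.inr j) y)) .out
  | .degree (.inl (.inr j)) s => .sample (answerLaw (reducedWeight c (fun (_ : A) (_ : B) => 0)) E
      (.degree (.inl (.inr j)) s)) .out
  | .neighbor (.inl (.inr j)) s =>
      .sample (answerLaw (reducedWeight c (fun (_ : A) (_ : B) => 0)) E
        (.neighbor (.inl (.inr j)) s)) .out

lemma atMost_reply (c : ℕ) (E : Explored (LeftCopies A B) B) (q : Query (LeftCopies A B) B) :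
    (reply c E q).AtMost (simulationBudget q.kind) := by
  rcases q with ⟨⟨x, i⟩ | j, y⟩ | ⟨(⟨x, i⟩ | j) | y, s⟩ | ⟨(⟨x, i⟩ | j) | y, s⟩
  · exact ⟨by simp [simulationBudget, Query.kind], fun _ => trivial⟩
  · exact QueryTree.AtMost.sample fun _ => trivial
  · exact atMost_neighborReply _ _ _ _ _
  · exact QueryTree.AtMost.sample fun _ => trivial
  · exact atMost_neighborReply _ _ _ _ _
  · exact ⟨by simp [simulationBudget, Query.kind], fun _ => trivial⟩
  · exact QueryTree.AtMost.sample fun _ => trivial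
  · exact ⟨by simp [simulationBudget, Query.kind], fun _ => trivial⟩

/-- The simulator; its memory holds the answers given so far to neighbor queries. -/
def reductionSimulator (c : ℕ) (A B : Type) [Fintype A] [Fintype B] :
    Simulator A B (LeftCopies A B) B where
  Memory := Explored (LeftCopies A B) B
  start := fun _ _ => ∅
  answer E q := (reply c E q).map (fun r => (E.update q r, r))

/-- All returned nodes are neighbors of the required weight. -/
def Explored.Valid {A B : Type} (w : A → B → ℕ) (E : Explored A B) : Prop :=
  ∀ z s, ∀ t ∈ E z s, edgeWeight w z t = some s

lemma Explored.Valid.update {A B : Type} [Fintype A] [Fintype B] {w : A → B → ℕ}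
    {E : Explored A B} (hE : E.Valid w)
    {q : Query A B} {r : Answer A B} (hr : r ∈ (answerLaw w E q).support) :
    (E.update q r).Valid w := by
  rintro z s t (ht | ⟨rfl, rfl⟩)
  · exact hE z s t ht
  · simp only [answerLaw] at hr
    split_ifs at hr with h
    · simp only [PMF.support_map, PMF.support_uniformOfFinset, Set.mem_image, Finset.mem_coe,
        Answer.node.injEq, Option.some.injEq, exists_eq_right] at hr
      simp only [mem_freshNbrs] at hr
      exact hr.1
    · simp at hr

variable {c : ℕ} {w : A → B → ℕ} {E : Explored (LeftCopies A B) B}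

lemma projExplored_valid (hE : E.Valid (reducedWeight c w)) : (projExplored E).Valid w := by
  rintro (x | y) s t ht
  · obtain ⟨y, i, rfl, h⟩ := ht
    simpa [edgeWeight, reducedWeight] using hE _ _ _ h
  · obtain ⟨x, i, rfl, h⟩ := ht
    simpa [edgeWeight, reducedWeight] using hE _ _ _ h

lemma projExplored_update_special (j : Fin (Fintype.card B % Fintype.card A)) (s : ℕ)
    (r : Answer (LeftCopies A B) B) :
    projExplored (E.update (.neighbor (.inl (.inr j)) s) r) = projExplored E := by
  funext z s'
  rcases z with x | y <;> simp [projExplored, Explored.update]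

lemma projExplored_update_left (x : A) (i : Fin (Fintype.card B / Fintype.card A)) (s : ℕ)
    (y : B) :
    projExplored (E.update (.neighbor (.inl (.inl (x, i))) s) (.node (some (.inr y)))) =
      (projExplored E).update (.neighbor (.inl x) s) (.node (some (.inr y))) := by
  funext z s'
  ext t
  rcases z with x' | y' <;> rcases t with x'' | y'' <;>
    simp [projExplored, Explored.update, exists_or]

lemma projExplored_update_right (x : A) (i : Fin (Fintype.card B / Fintype.card A)) (s : ℕ)
    (y : B) :
    projExplored (E.update (.neighbor (.inr y) s) (.node (some (.inl (.inl (x, i)))))) =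
      (projExplored E).update (.neighbor (.inr y) s) (.node (some (.inl x))) := by
  funext z s'
  ext t
  rcases z with x' | y' <;> rcases t with x'' | y'' <;>
    simp [projExplored, Explored.update, exists_or]

lemma projExplored_update_right_special (j : Fin (Fintype.card B % Fintype.card A)) (s : ℕ)
    (y : B) :
    projExplored (E.update (.neighbor (.inr y) s) (.node (some (.inl (.inr j))))) =
      projExplored E := by
  funext z s'
  rcases z with x' | y' <;> simp [projExplored, Explored.update]

/-- Needed for answers taken from the known nodes: no original query is asked, and the projected
record already contains them. -/
lemma Explored.update_of_mem {A B : Type} {E : Explored A B} {z t : A ⊕ B} {s : ℕ}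
    (h : t ∈ E z s) : E.update (.neighbor z s) (.node (some t)) = E := by
  funext z' s'
  ext t'
  simp only [Explored.update, Set.mem_union, Set.mem_ofPred_eq, or_iff_left_iff_imp]
  rintro ⟨h1, h2⟩
  cases h1; cases h2; exact h

lemma card_weightNbrs_right (c : ℕ) (w : A → B → ℕ) (y : B) (s : ℕ) :
    (weightNbrs (reducedWeight c w) (.inr y) s).card =
      (weightNbrs w (.inr y) s).card * (Fintype.card B / Fintype.card A) +
        if s = c then Fintype.card B % Fintype.card A else 0 := by
  classical
  simp only [card_weightNbrs, Fintype.sum_sum_type, Fintype.sum_prod_type]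
  simp [mul_comm, eq_comm]
  rw [← Finset.sum_filter, Finset.sum_const, smul_eq_mul, mul_comm]

lemma card_weightNbrs_left (c : ℕ) (w : A → B → ℕ) (x : A)
    (i : Fin (Fintype.card B / Fintype.card A)) (s : ℕ) :
    (weightNbrs (reducedWeight c w) (.inl (.inl (x, i))) s).card =
      (weightNbrs w (.inl x) s).card := by
  classical
  simp only [card_weightNbrs, Fintype.sum_sum_type]
  simp

/-- All edges at a special node have weight `c` whatever `w` is. Hence `reply`, which must not
depend on `w`, may use the zero weights instead. -/
lemma answerLaw_special (w : A → B → ℕ) (E : Explored (LeftCopies A B) B)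
    (j : Fin (Fintype.card B % Fintype.card A)) (s : ℕ) :
    answerLaw (reducedWeight c w) E (.neighbor (.inl (.inr j)) s) =
      answerLaw (reducedWeight c (fun (_ : A) (_ : B) => 0)) E (.neighbor (.inl (.inr j)) s) := by
  have : freshNbrs (reducedWeight c w) E (.inl (.inr j)) s =
      freshNbrs (reducedWeight c (fun (_ : A) (_ : B) => 0)) E (.inl (.inr j)) s := by
    ext t
    rcases t with (t | t) | t <;> simp
  simp only [answerLaw, this]

lemma weightNbrs_special (w : A → B → ℕ) (j : Fin (Fintype.card B % Fintype.card A))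
    (s : ℕ) : weightNbrs (reducedWeight c w) (.inl (.inr j)) s =
      weightNbrs (reducedWeight c (fun (_ : A) (_ : B) => 0)) (.inl (.inr j)) s := by
  ext t
  rcases t with (t | t) | t <;> simp

/-- One step of the simulation. The right side continues from the projection of the updated record,
so the lemma matches the answer jointly with the explored nodes of the original graph; the law of
the answer alone would not support the induction. -/
lemma lawFrom_reply {O : Type} (hE : E.Valid (reducedWeight c w))
    (q : Query (LeftCopies A B) B) (f : Answer (LeftCopies A B) B → QueryTree A B O) :
    ((reply c E q).bind f).lawFrom w (projExplored E) =
      (answerLaw (reducedWeight c w) E q).bind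
        (fun r => (f r).lawFrom w (projExplored (E.update q r))) := by
  have hP := projExplored_valid hE
  rcases q with ⟨⟨x, i⟩ | j, y⟩ | ⟨(⟨x, i⟩ | j) | y, s⟩ | ⟨(⟨x, i⟩ | j) | y, s⟩
  · simp only [reply, QueryTree.bind, QueryTree.lawFrom, answerLaw, PMF.pure_bind, reducedWeight]
    rw [Explored.update_of_ne _ (by simp), Explored.update_of_ne _ (by simp)]
  · simp only [reply, QueryTree.bind_sample, QueryTree.lawFrom_sample, QueryTree.bind, answerLaw,
      PMF.pure_bind, reducedWeight]
    rw [Explored.update_of_ne _ (by simp)]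
  · refine lawFrom_neighborReply w _ (projExplored E) E _ _ s _ _
      (fun r => projExplored (E.update _ r)) ?_ ?_ ?_ ?_ ?_ ?_ ?_ f
    · intro t ht
      simpa using hP _ _ _ ht
    · rintro ((⟨x', i'⟩ | j') | y')
      · simp [IsKnown, liftRight]
      · simp [IsKnown, liftRight]
      -- A node returned at this copy counts as explored at x, and a node explored at x has weight s
      -- to it by validity. Given these, fresh at the copy means known or fresh at x, by
      -- propositional logic.
      · have h1 : Sum.inr y' ∈ E (.inl (.inl (x, i))) s →
            Sum.inr y' ∈ projExplored E (.inl x) s := fun h => ⟨y', i, rfl, h⟩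
        have h2 := hP (.inl x) s (.inr y')
        simp only [edgeWeight, Option.some.injEq] at h2
        simp only [mem_freshNbrs, mem_knownFresh, IsKnown, liftRight,
          edgeWeight_inl_inr, edgeWeight_inl_inl,
          reducedWeight_inl, Option.some.injEq,
          Sum.exists, reduceCtorEq, false_and, exists_false, false_or, exists_const,
          Sum.inr.injEq, exists_eq_right]
        tauto
    · rintro (x' | y') hx u
      · simp at hx
      · simp only [mem_freshNbrs] at hx
        simp [IsKnown, liftRight, hx.2]
    · rintro (x' | y') hx (x'' | y'') hx' u u'
      · simp at hx
      · simp at hx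
      · simp at hx'
      · simp [liftRight]
    · exact congrArg projExplored (Explored.update_of_ne _ (by simp))
    · rintro ((t | t) | y') ht
      · simp [IsKnown] at ht
      · simp [IsKnown] at ht
      · simp only [mem_knownFresh, IsKnown] at ht
        exact (projExplored_update_left x i s y').trans (Explored.update_of_mem (by exact ht.2))
    · rintro (x' | y') hx u
      · simp at hx
      · exact projExplored_update_left x i s y'
  · simp only [reply, QueryTree.bind_sample, QueryTree.lawFrom_sample, QueryTree.bind,
      projExplored_update_special, answerLaw_special w]
  · refine lawFrom_neighborReply w _ (projExplored E) E _ _ s _ _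
      (fun r => projExplored (E.update _ r)) ?_ ?_ ?_ ?_ ?_ ?_ ?_ f
    · intro t ht
      simpa using hP _ _ _ ht
    · rintro ((⟨x', i'⟩ | j') | y')
      · have h1 : Sum.inl (Sum.inl (x', i')) ∈ E (.inr y) s →
            Sum.inl x' ∈ projExplored E (.inr y) s := fun h => ⟨x', i', rfl, h⟩
        have h2 := hP (.inr y) s (.inl x')
        simp only [edgeWeight, Option.some.injEq] at h2
        simp only [mem_freshNbrs, mem_knownFresh, IsKnown, liftLeft,
          edgeWeight_inr_inl, edgeWeight_inr_inr,
          reducedWeight_inl, Option.some.injEq,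
          Sum.exists, reduceCtorEq, false_and, exists_false, or_false,
          Sum.inl.injEq, Prod.mk.injEq]
        -- A copy determines its original and its index. So a fresh copy of x' is either known,
        -- through another returned copy of x', or x' itself is unexplored.
        have h3 : (∃ a, (w a y = s ∧ Sum.inl a ∉ projExplored E (Sum.inr y) s) ∧
            ∃ i, a = x' ∧ i = i') ↔ (w x' y = s ∧ Sum.inl x' ∉ projExplored E (Sum.inr y) s) := by
          simp
        rw [h3]
        tauto
      · simp [IsKnown, liftLeft, reducedWeight,
          and_comm, eq_comm]
      · simp [IsKnown, liftLeft]
    · rintro (x' | y') hx u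
      · simp only [mem_freshNbrs] at hx
        simp [IsKnown, liftLeft, hx.2]
      · simp at hx
    · rintro (x' | y') hx (x'' | y'') hx' u u'
      · simp [liftLeft]
      · simp at hx'
      · simp at hx
      · simp at hx
    · exact congrArg projExplored (Explored.update_of_ne _ (by simp))
    · rintro ((⟨x', i'⟩ | t) | y') ht
      · simp only [mem_knownFresh, IsKnown] at ht
        exact (projExplored_update_right x' i' s y).trans (Explored.update_of_mem (by exact ht.2))
      · exact projExplored_update_right_special t s y
      · simp [IsKnown] at ht
    · rintro (x' | y') hx u
      · exact projExplored_update_right x' u s y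
      · simp at hx
  · simp only [reply, QueryTree.bind, QueryTree.lawFrom, answerLaw, PMF.pure_bind,
      card_weightNbrs_left]
    rw [Explored.update_of_ne _ (by simp), Explored.update_of_ne _ (by simp)]
  · simp only [reply, QueryTree.bind_sample, QueryTree.lawFrom_sample, QueryTree.bind, answerLaw,
      PMF.pure_bind, weightNbrs_special w]
    rw [Explored.update_of_ne _ (by simp)]
  · simp only [reply, QueryTree.bind, QueryTree.lawFrom, answerLaw, PMF.pure_bind,
      card_weightNbrs_right]
    rw [Explored.update_of_ne _ (by simp), Explored.update_of_ne _ (by simp)]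

/-- The induction needs an arbitrary valid record, with exactly its projection explored in the
original graph; `law_run` is the empty record. -/
lemma lawFrom_runFrom {O : Type} (t : QueryTree (LeftCopies A B) B O)
    (hE : E.Valid (reducedWeight c w)) :
    ((reductionSimulator c A B).runFrom t E).lawFrom w (projExplored E) =
      t.lawFrom (reducedWeight c w) E := by
  induction t generalizing E with
  | out o => rfl
  | toss μ k ih => exact congrArg μ.bind (funext fun i => ih i hE)
  | ask q k ih =>
    change (((reply c E q).map (fun r => (E.update q r, r))).bind _).lawFrom w _ = _
    refine (congrArg (fun t => QueryTree.lawFrom w t (projExplored E))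
      (QueryTree.bind_map _ _ _)).trans ((lawFrom_reply hE q _).trans ?_)
    exact pmf_bind_congr _ fun r hr => ih r (hE.update hr)

lemma law_run (c : ℕ) (w : A → B → ℕ) {O : Type} (t : QueryTree (LeftCopies A B) B O) :
    ((reductionSimulator c A B).run t).law w = t.law (reducedWeight c w) := by
  have h := lawFrom_runFrom (c := c) (w := w) (E := fun _ _ => ∅) t (fun _ _ _ h => h.elim)
  have h0 : projExplored (fun _ _ => ∅ : Explored (LeftCopies A B) B) = fun _ _ => ∅ := by
    funext z s
    rcases z with x | y <;> simp [projExplored]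
  rw [h0] at h
  exact h

end Simulator

/-! ## The estimates -/

lemma EstimatesEqualDegree.localized {c : ℕ} (hc : c ≤ 3) {𝔅 : LocalAlgorithm} {α ε : ℝ}
    {p : ℝ≥0∞} (h𝔅 : EstimatesEqualDegree 𝔅 α ε p) {A B : Type} [Fintype A] [Fintype B]
    [Nonempty B] (Z : A → B → Prop) (w : A → B → ℕ) (hw : ∀ x y, w x y ≤ 3)
    (hZ : ∀ x y, Z x y ↔ w x y = 0) {T : Set ℝ}
    (hT : ∀ γ, IsEstimateOf α ε (bipartiteCurvature (reducedWeight c w : LeftCopies A B → B → ℕ)) γ →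
      γ - (3 - (c : ℝ)) * ((Fintype.card B % Fintype.card A : ℕ) : ℝ) / (Fintype.card B : ℝ) ∈ T) :
    p ≤ ((LocalCurvature.localized c (fun A B _ _ _ => reductionSimulator c A B) 𝔅 A B Z).law
      w).toOuterMeasure T := by
  have hne : Nonempty (LeftCopies A B) := by
    rw [← Fintype.card_pos_iff, card_leftCopies]; exact Fintype.card_pos
  -- `𝔅` receives a relation computed without `w`; its guarantee applies because this is the true
  -- zero-weight relation of the reduced graph.
  have hZ' : reducedZero c Z =
      fun (x : LeftCopies A B) (y : B) => reducedWeight c w x y = 0 := by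
    funext x y
    rcases x with x | j
    · exact propext (hZ x.1 y)
    · rfl
  have h := h𝔅 (LeftCopies A B) B card_leftCopies (reducedWeight c w) (by
    rintro (x | j) y
    · exact hw x.1 y
    · exact hc)
  rw [← hZ', ← law_run] at h
  refine h.trans ?_
  simp only [LocalCurvature.localized]
  rw [show ∀ (t : QueryTree A B ℝ) (f : ℝ → ℝ), (t.map f).law w = (t.law w).map f from
    fun t f => QueryTree.lawFrom_map w t f _, PMF.toOuterMeasure_map_apply]
  exact MeasureTheory.measure_mono hT

lemma bipartiteCurvature_le_reduced {A B : Type} [Fintype A] [Fintype B] [Nonempty A] [Nonempty B]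
    (c : ℕ) (w : A → B → ℕ) :
    bipartiteCurvature w ≤ bipartiteCurvature (reducedWeight c w : LeftCopies A B → B → ℕ) +
      (c : ℝ) * ((Fintype.card B % Fintype.card A : ℕ) : ℝ) / (Fintype.card B : ℝ) := by
  have := emd_reduced_le_emd c w
  unfold bipartiteCurvature
  linarith

lemma reduced_le_bipartiteCurvature {A B : Type} [Fintype A] [Fintype B] [Nonempty A] [Nonempty B]
    (c : ℕ) (w : A → B → ℕ) (hw : ∀ x y, w x y ≤ 3) :
    bipartiteCurvature (reducedWeight c w : LeftCopies A B → B → ℕ) ≤ bipartiteCurvature w +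
      (3 - (c : ℝ)) * ((Fintype.card B % Fintype.card A : ℕ) : ℝ) / (Fintype.card B : ℝ) := by
  have := emd_le_emd_reduced c w hw
  unfold bipartiteCurvature
  linarith

/-- The estimate for the reduced graph, corrected by the known number, is an estimate for the
original graph. -/
lemma IsEstimateOf.of_reduced {A B : Type} [Fintype A] [Fintype B] [Nonempty A] [Nonempty B]
    {c : ℕ} {w : A → B → ℕ} (hw : ∀ x y, w x y ≤ 3) {α ε ε' γ : ℝ} (hα : 0 ≤ α)
    (hε : ε + (α * c + (3 - c)) *
      (((Fintype.card B % Fintype.card A : ℕ) : ℝ) / (Fintype.card B : ℝ)) ≤ ε')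
    (h : IsEstimateOf α ε (bipartiteCurvature (reducedWeight c w : LeftCopies A B → B → ℕ)) γ) :
    IsEstimateOf α ε' (bipartiteCurvature w)
      (γ - (3 - (c : ℝ)) * ((Fintype.card B % Fintype.card A : ℕ) : ℝ) / (Fintype.card B : ℝ)) := by
  have h1 := bipartiteCurvature_le_reduced c w
  have h2 := reduced_le_bipartiteCurvature c w hw
  obtain ⟨h3, h4⟩ := h
  rw [mul_div_assoc] at *
  -- The lower bound uses `h2`; the upper bound uses `h1` multiplied by α ≥ 0.
  refine ⟨by linarith, ?_⟩
  have := mul_le_mul_of_nonneg_left h1 hα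
  linarith

/-! ### Application to an edge of a graph -/

section Edge

variable {V : Type} [Fintype V] [DecidableEq V] (G : SimpleGraph V) [DecidableRel G.Adj]

instance nonempty_closedNbr (u : V) : Nonempty (closedNbr G u) :=
  ⟨⟨u, Finset.mem_insert_self _ _⟩⟩

lemma card_closedNbr (u : V) : Fintype.card (closedNbr G u) = G.degree u + 1 := by
  rw [Fintype.card_coe, closedNbr, Finset.card_insert_of_notMem (by simp),
    G.card_neighborFinset_eq_degree]

variable {G}

lemma exists_walk_of_mem_closedNbr {u x : V} (hx : x ∈ closedNbr G u) :
    ∃ p : G.Walk u x, p.length ≤ 1 := by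
  simp only [closedNbr, Finset.mem_insert, SimpleGraph.mem_neighborFinset] at hx
  rcases hx with rfl | h
  · exact ⟨.nil, by simp⟩
  · exact ⟨.cons h .nil, by simp⟩

/-- The walk passes through the edge: x, u, v, y, where the outer steps may be trivial. -/
lemma exists_walk_closedNbr {u v : V} (h : G.Adj u v) (x : closedNbr G u) (y : closedNbr G v) :
    ∃ p : G.Walk x.1 y.1, p.length ≤ 3 := by
  obtain ⟨p, hp⟩ := exists_walk_of_mem_closedNbr x.2
  obtain ⟨q, hq⟩ := exists_walk_of_mem_closedNbr y.2
  refine ⟨p.reverse.append (.cons h q), ?_⟩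
  simp only [SimpleGraph.Walk.length_append, SimpleGraph.Walk.length_reverse,
    SimpleGraph.Walk.length_cons]
  omega

lemma distWeight_le_three {u v : V} (h : G.Adj u v) (x : closedNbr G u) (y : closedNbr G v) :
    distWeight G u v x y ≤ 3 := by
  obtain ⟨p, hp⟩ := exists_walk_closedNbr h x y
  exact (SimpleGraph.dist_le p).trans hp

/-- `SimpleGraph.dist` is also 0 between disconnected vertices; the walk through the edge excludes
this. -/
lemma distWeight_eq_zero_iff {u v : V} (h : G.Adj u v) (x : closedNbr G u) (y : closedNbr G v) :
    x.1 = y.1 ↔ distWeight G u v x y = 0 := by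
  obtain ⟨p, -⟩ := exists_walk_closedNbr h x y
  exact p.reachable.dist_eq_zero_iff.symm

lemma edgeCurvature_eq (u v : V) :
    edgeCurvature G u v = bipartiteCurvature (distWeight G u v) := by
  unfold edgeCurvature bipartiteCurvature
  simp only [card_closedNbr, Nat.cast_add, Nat.cast_one, add_comm]

lemma estimatesEdge_localized {c : ℕ} (hc : c ≤ 3) {𝔅 : LocalAlgorithm} {α ε ε' : ℝ}
    {p : ℝ≥0∞} (hα : 0 ≤ α) (h𝔅 : EstimatesEqualDegree 𝔅 α ε p) {u v : V} (h : G.Adj u v)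
    (hε : ε + (α * c + (3 - c)) * (((G.degree v + 1) % (G.degree u + 1) : ℕ) /
      ((G.degree v : ℝ) + 1)) ≤ ε') :
    EstimatesEdge G u v (localized c (fun A B _ _ _ => reductionSimulator c A B) 𝔅) α ε' p := by
  refine h𝔅.localized hc _ _ (distWeight_le_three h) (distWeight_eq_zero_iff h) fun γ hγ => ?_
  rw [Set.mem_ofPred_eq, edgeCurvature_eq]
  refine hγ.of_reduced (distWeight_le_three h) hα ?_
  simpa only [card_closedNbr, Nat.cast_add, Nat.cast_one] using hε

/-- The fraction of special nodes is small if the degrees are far apart or almost equal. -/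
lemma three_mul_mod_div_le {d e : ℕ} (hde : d < e) {δ : ℝ}
    (h : (d : ℝ) ≤ δ / 3 * e ∨ (1 - δ / 3) * (e : ℝ) ≤ d) (hδ : 0 < δ) :
    3 * (((e + 1) % (d + 1) : ℕ) / ((e : ℝ) + 1)) ≤ δ := by
  have hmod : ((e + 1) % (d + 1) : ℕ) ≤ δ / 3 * (e : ℝ) := by
    rcases h with h | h
    · have : (e + 1) % (d + 1) ≤ d := Nat.lt_succ_iff.1 (Nat.mod_lt _ d.succ_pos)
      exact (Nat.cast_le.2 this).trans h
    -- Since d < e, subtracting d + 1 once leaves e - d, which bounds the remainder.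
    · have h1 : (e + 1) % (d + 1) ≤ e - d := by
        rw [Nat.mod_eq_sub_mod (by omega)]
        exact (Nat.mod_le _ _).trans (by omega)
      have h2 : (((e + 1) % (d + 1) : ℕ) : ℝ) ≤ (e : ℝ) - d := by
        rw [← Nat.cast_sub hde.le]; exact Nat.cast_le.2 h1
      linarith
  rw [← mul_div_assoc, div_le_iff₀ (by positivity)]
  linarith

end Edge

end LocalCurvature

end

theorem mainTheorem4 (c : ℕ) (hc : c ≤ 3) :
    ∃ S : ∀ (A B : Type) [Fintype A] [Fintype B],
        (A → B → Prop) → LocalCurvature.Simulator A B (LocalCurvature.LeftCopies A B) B,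
      -- (a) cost of answering one query
      (∀ (A B : Type) [Fintype A] [Fintype B] (Z : A → B → Prop) (σ : (S A B Z).Memory)
          (q : LocalCurvature.Query (LocalCurvature.LeftCopies A B) B),
        ((S A B Z).answer σ q).AtMost (LocalCurvature.simulationBudget q.kind)) ∧
      ∀ (V : Type) [Fintype V] [DecidableEq V] (G : SimpleGraph V) [DecidableRel G.Adj] (u v : V),
        G.Adj u v → G.degree u < G.degree v →
          -- exactness of the simulation
          (∀ (O : Type)
              (t : LocalCurvature.QueryTree
                (LocalCurvature.LeftCopies (LocalCurvature.closedNbr G u)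
                  (LocalCurvature.closedNbr G v))
                (LocalCurvature.closedNbr G v) O),
            ((S _ _ (fun x y => x.1 = y.1)).run t).law (LocalCurvature.distWeight G u v)
              = t.law (LocalCurvature.reducedWeight c (LocalCurvature.distWeight G u v))) ∧
          ∀ (𝔅 : LocalCurvature.LocalAlgorithm) (α ε : ℝ) (p : ENNReal), 0 ≤ α →
            LocalCurvature.EstimatesEqualDegree 𝔅 α ε p →
              -- (b)
              ((G.degree u + 1 ∣ G.degree v + 1) →
                LocalCurvature.EstimatesEdge G u v (LocalCurvature.localized c S 𝔅) α ε p) ∧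
              -- (c)
              ((c = 0 ∨ α ≤ 1) → ∀ δ : ℝ, 0 < δ →
                ((G.degree u : ℝ) ≤ δ / 3 * G.degree v ∨
                  (1 - δ / 3) * (G.degree v : ℝ) ≤ G.degree u) →
                LocalCurvature.EstimatesEdge G u v (LocalCurvature.localized c S 𝔅)
                  α (ε + δ) p) := by
  refine ⟨fun A B _ _ _ => LocalCurvature.reductionSimulator c A B,
    fun A B _ _ _ σ q => (LocalCurvature.atMost_reply c σ q).map, ?_⟩
  intro V _ _ G _ u v huv hdeg
  refine ⟨fun O t => LocalCurvature.law_run c _ t, fun 𝔅 α ε p hα h𝔅 => ⟨fun hdvd => ?_, ?_⟩⟩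
  · refine LocalCurvature.estimatesEdge_localized hc hα h𝔅 huv ?_
    simp [Nat.mod_eq_zero_of_dvd hdvd]
  · intro hcα δ hδ hsmall
    refine LocalCurvature.estimatesEdge_localized hc hα h𝔅 huv ?_
    have h3 := LocalCurvature.three_mul_mod_div_le hdeg hsmall hδ
    -- The only use of c = 0 or α ≤ 1: the error factor αc + 3 - c is then at most 3.
    have hfac : α * c + (3 - c) ≤ 3 := by
      rcases hcα with rfl | h
      · simp
      · linarith [mul_le_of_le_one_left (Nat.cast_nonneg (α := ℝ) c) h]
    have := mul_le_mul_of_nonneg_right hfac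
      (by positivity : (0 : ℝ) ≤ ((G.degree v + 1) % (G.degree u + 1) : ℕ) / ((G.degree v : ℝ) + 1))
    linarith
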